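/- Let $0<\alpha<1$, $T>0$, $J=[0,T]$, and let $B:[0,1]\to(0,\infty)$ be a normalization function, i.e. $B(0)=B(1)=1$. Let $$\mathbb{E}_\alpha(z)=\sum_{n=0}^{\infty}\frac{z^n}{\Gamma(n\alpha+1)}$$ be the one-parameter Mittag-Leffler function. For a function $\omega$ that is differentiable on $J$ with $\omega'$ Lebesgue integrable on $(0,T)$ (for instance, $\omega$ differentiable on $J$ and $\omega\in H^1(0,T)$), its Atangana--Baleanu--Caputo (ABC) fractional derivative of order $\alpha$ is $$\left({}^{ABC}{}_0\mathcal{D}^\alpha\omega\right)(\tau)=\frac{B(\alpha)}{1-\alpha}\int_0^\tau \mathbb{E}_\alpha\!\left[-\frac{\alpha}{1-\alpha}(\tau-\sigma)^\alpha\right]\omega'(\sigma)\,d\sigma,\qquad \tau\in J.$$ Let $m:J\to\mathbb{R}$ be differentiable on $J$ (one-sidedly at the end points) with $m'$ Lebesgue integrable on $(0,T)$, and suppose that ${}^{ABC}{}_0\mathcal{D}^\alpha m$ is continuous on $J$. Let $\tau_0\in(0,T]$ with $m(\tau_0)=0$. (i) If $m(\tau)\le 0$ for all $\tau\in[0,\tau_0)$,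 then $\left({}^{ABC}{}_0\mathcal{D}^\alpha m\right)(\tau_0)\ge 0$. (ii) If $m(\tau)\ge 0$ for all $\tau\in[0,\tau_0)$, then $\left({}^{ABC}{}_0\mathcal{D}^\alpha m\right)(\tau_0)\le 0$. -/

import Mathlib

open MeasureTheory Set

/-- The one-parameter Mittag-Leffler function `E_α(z) = ∑_{n ≥ 0} z ^ n / Γ(n α + 1)`
at a real argument. The series converges for every real `z` when `0 < α`. -/
noncomputable def mittagLeffler (α z : ℝ) : ℝ :=
  ∑' n : ℕ, z ^ n / Real.Gamma (n * α + 1)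

/-- The left Atangana-Baleanu-Caputo fractional derivative of order `α`, with base point `0` and
normalization function `B`, of the function `ω` at the point `τ`:
`B(α) / (1 - α) * ∫_0^τ E_α(-(α / (1 - α)) (τ - σ) ^ α) ω'(σ) dσ`.
For `ω` defined on `[0, T]` and `τ ≤ T`, the integrand at points `σ` of the open interval `(0, τ)`
only sees the values of `ω` on `[0, T]`, and the end points do not matter for the integral. -/
noncomputable def abcDeriv (B : ℝ → ℝ) (α : ℝ) (ω : ℝ → ℝ) (τ : ℝ) : ℝ :=
  B α / (1 - α) *
    ∫ σ in (0 : ℝ)..τ, mittagLeffler α (-(α / (1 - α)) * (τ - σ) ^ α) * deriv ω σ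

/-- `B` is a normalization function: positive on `[0, 1]` with `B(0) = B(1) = 1`. -/
def IsNormalization (B : ℝ → ℝ) : Prop :=
  (∀ a ∈ Icc (0 : ℝ) 1, 0 < B a) ∧ B 0 = 1 ∧ B 1 = 1

/-! Let k(t) = E_α(-c t^α) with c = α/(1-α). Integrating by parts against k(τ₀ - σ), the boundary
term at τ₀ vanishes and -k(τ₀) m(0) - ∫ (d/dσ)[k(τ₀ - σ)] m(σ) dσ remains. If k is positive and
decreasing, both terms are nonnegative when m ≤ 0; part (ii) is part (i) for -m.

The two properties of k are derived without complete monotonicity. By `mittagLeffler_volterra`, k =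
1 - C ∫ (t-s)^(α-1) k(s) ds, and t ↦ k(t) - k(t+h) solves the same equation with another positive
forcing term. A first-zero argument, `pos_of_volterra`, makes both solutions positive. -/

/-! ### Convergence and smoothness of the Mittag-Leffler series -/

theorem rpow_mul_exp_neg_le_Gamma {A x : ℝ} (hA : 0 ≤ A) (hx : 0 ≤ x) :
    A ^ x * Real.exp (-A) ≤ Real.Gamma (x + 1) := by
  have hint := Real.GammaIntegral_convergent (s := x + 1) (by linarith)
  have hsub : Ioi A ⊆ Ioi 0 := Ioi_subset_Ioi hA
  rw [Real.Gamma_eq_integral (by linarith)]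
  calc A ^ x * Real.exp (-A) = ∫ t in Ioi A, A ^ x * Real.exp (-t) := by
        rw [integral_const_mul, integral_exp_neg_Ioi]
    _ ≤ ∫ t in Ioi A, Real.exp (-t) * t ^ (x + 1 - 1) := by
        refine setIntegral_mono_on ((integrableOn_exp_neg_Ioi A).const_mul _)
          (hint.mono_set hsub) measurableSet_Ioi fun t ht => ?_
        rw [add_sub_cancel_right, mul_comm]
        exact mul_le_mul_of_nonneg_left (Real.rpow_le_rpow hA (le_of_lt ht) hx)
          (Real.exp_pos _).le
    _ ≤ ∫ t in Ioi 0, Real.exp (-t) * t ^ (x + 1 - 1) := by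
        refine setIntegral_mono_set hint ?_ hsub.eventuallyLE
        filter_upwards [ae_restrict_mem measurableSet_Ioi] with t ht
        exact mul_nonneg (Real.exp_pos _).le (Real.rpow_nonneg (le_of_lt ht) _)

theorem Gamma_natCast_mul_add_one_pos {α : ℝ} (hα : 0 < α) (n : ℕ) :
    0 < Real.Gamma (n * α + 1) :=
  Real.Gamma_pos_of_pos (by positivity)

theorem summable_pow_div_Gamma {α : ℝ} (hα : 0 < α) (z : ℝ) :
    Summable fun n : ℕ => z ^ n / Real.Gamma (n * α + 1) := by
  set R : ℝ := |z| + 1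
  have hR : 0 < R := by positivity
  -- With this A, Γ(nα+1) ≥ (2R)^n e^(-A), so the terms are dominated by e^A 2^(-n).
  set A : ℝ := (2 * R) ^ (1 / α)
  have hA : A ^ α = 2 * R := by
    rw [← Real.rpow_mul (by positivity), one_div_mul_cancel hα.ne', Real.rpow_one]
  refine Summable.of_norm_bounded (g := fun n : ℕ => Real.exp A * (1 / 2) ^ n)
    ((summable_geometric_two).mul_left _) fun n => ?_
  have hG := rpow_mul_exp_neg_le_Gamma (A := A) (x := n * α) (by positivity) (by positivity)
  rw [mul_comm (n : ℝ) α, Real.rpow_mul (by positivity), hA, Real.rpow_natCast, Real.exp_neg,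
    mul_comm α] at hG
  rw [norm_div, norm_pow, Real.norm_eq_abs, Real.norm_eq_abs,
    abs_of_pos (Gamma_natCast_mul_add_one_pos hα n),
    div_le_iff₀ (Gamma_natCast_mul_add_one_pos hα n)]
  have hz : |z| ^ n ≤ R ^ n := pow_le_pow_left₀ (abs_nonneg z) (by simp [R]) n
  calc |z| ^ n ≤ R ^ n := hz
    _ = Real.exp A * (1 / 2) ^ n * ((2 * R) ^ n * (Real.exp A)⁻¹) := by
        rw [mul_pow, one_div, inv_pow]; field_simp
    _ ≤ _ := by gcongr

theorem differentiable_mittagLeffler {α : ℝ} (hα : 0 < α) :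
    Differentiable ℝ (mittagLeffler α) := by
  intro z
  set R : ℝ := |z| + 1
  have hR : 1 ≤ R := by simp [R]
  refine (hasDerivAt_tsum_of_isPreconnected
    (u := fun n : ℕ => (2 * R) ^ n / Real.Gamma (n * α + 1))
    (g := fun (n : ℕ) (z : ℝ) => z ^ n / Real.Gamma (n * α + 1))
    (g' := fun (n : ℕ) (z : ℝ) => n * z ^ (n - 1) / Real.Gamma (n * α + 1))
    (t := Metric.ball 0 R) (y₀ := z)
    (summable_pow_div_Gamma hα _) Metric.isOpen_ball
    (convex_ball _ _).isPreconnected (fun n y _ => (hasDerivAt_pow n y).div_const _)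
    (fun n y hy => ?_) (by simp [R]) (summable_pow_div_Gamma hα z)
    (by simp [R])).differentiableAt
  have hG := Gamma_natCast_mul_add_one_pos hα n
  rw [norm_div, norm_mul, norm_pow, Real.norm_of_nonneg hG.le, RCLike.norm_natCast]
  have hy' : ‖y‖ ≤ R := (mem_ball_zero_iff.1 hy).le
  have h1 : ‖y‖ ^ (n - 1) ≤ R ^ n :=
    (pow_le_pow_left₀ (norm_nonneg y) hy' _).trans (pow_le_pow_right₀ hR (Nat.sub_le _ _))
  have h2 : (n : ℝ) ≤ 2 ^ n := by exact_mod_cast (Nat.lt_two_pow_self (n := n)).le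
  rw [mul_pow]
  gcongr

/-! ### Abel kernel and the Volterra equation -/

theorem intervalIntegrable_sub_rpow {α : ℝ} (hα : 0 < α) (t a b : ℝ) :
    IntervalIntegrable (fun s => (t - s) ^ (α - 1)) volume a b := by
  have h := (intervalIntegral.intervalIntegrable_rpow' (r := α - 1) (by linarith)
    (a := t - a) (b := t - b)).comp_sub_left t
  simpa using h

theorem integral_sub_rpow_mul_rpow {α β t : ℝ} (hα : 0 < α) (hβ : 0 < β) (ht : 0 < t) :
    ∫ s in (0 : ℝ)..t, (t - s) ^ (α - 1) * s ^ (β - 1) =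
      t ^ (α + β - 1) * (Real.Gamma α * Real.Gamma β / Real.Gamma (α + β)) := by
  have h := Complex.betaIntegral_scaled (β : ℂ) (α : ℂ) ht
  have hb := Complex.betaIntegral_eq_Gamma_mul_div (β : ℂ) (α : ℂ) (by simpa) (by simpa)
  rw [hb] at h
  apply Complex.ofReal_injective
  rw [← intervalIntegral.integral_ofReal]
  convert h using 1
  · refine intervalIntegral.integral_congr fun s hs => ?_
    rw [uIcc_of_le ht.le] at hs
    push_cast
    rw [Complex.ofReal_cpow (sub_nonneg.2 hs.2), Complex.ofReal_cpow hs.1]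
    push_cast
    ring
  · push_cast
    rw [Complex.ofReal_cpow ht.le]
    simp only [← Complex.Gamma_ofReal]
    push_cast
    rw [add_comm (β : ℂ), mul_comm (Complex.Gamma β)]

/-- The function `t ↦ E_α(-c t ^ α)` solves the fractional relaxation equation in its Volterra
form. -/
theorem mittagLeffler_volterra {α c t : ℝ} (hα : 0 < α) (hc : 0 < c) (ht : 0 ≤ t) :
    mittagLeffler α (-c * t ^ α) = 1 - c / Real.Gamma α *
      ∫ s in (0 : ℝ)..t, (t - s) ^ (α - 1) * mittagLeffler α (-c * s ^ α) := by
  have hΓ := Real.Gamma_pos_of_pos hα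
  rcases ht.eq_or_lt with rfl | ht
  · rw [intervalIntegral.integral_same, Real.zero_rpow hα.ne', mul_zero, mul_zero, sub_zero,
      mittagLeffler, tsum_eq_single 0 (fun n hn => by simp [hn])]
    simp
  have hsum := summable_pow_div_Gamma hα (c * t ^ α)
  have key : HasSum (fun n : ℕ => ∫ s in (0 : ℝ)..t,
      (t - s) ^ (α - 1) * ((-c * s ^ α) ^ n / Real.Gamma (n * α + 1)))
      (∫ s in (0 : ℝ)..t, (t - s) ^ (α - 1) * mittagLeffler α (-c * s ^ α)) := by
    refine intervalIntegral.hasSum_integral_of_dominated_convergence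
      (fun n s => (t - s) ^ (α - 1) * ((c * t ^ α) ^ n / Real.Gamma (n * α + 1)))
      (fun n => ?_) (fun n => ?_) ?_ ?_ ?_
    · exact (by fun_prop : Measurable _).aestronglyMeasurable
    · refine Filter.Eventually.of_forall fun s hs => ?_
      rw [uIoc_of_le ht.le] at hs
      have h1 : 0 ≤ t - s := sub_nonneg.2 hs.2
      have h2 : s ^ α ≤ t ^ α := Real.rpow_le_rpow hs.1.le hs.2 hα.le
      have h3 : 0 ≤ s ^ α := Real.rpow_nonneg hs.1.le _
      have hG := Gamma_natCast_mul_add_one_pos hα n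
      rw [norm_mul, norm_div, norm_pow, norm_mul, norm_neg, Real.norm_of_nonneg hc.le,
        Real.norm_of_nonneg h3, Real.norm_of_nonneg (Real.rpow_nonneg h1 _),
        Real.norm_of_nonneg hG.le]
      gcongr
    · exact Filter.Eventually.of_forall fun s _ => hsum.mul_left _
    · simp_rw [tsum_mul_left]
      exact (intervalIntegrable_sub_rpow hα t 0 t).mul_const _
    · exact Filter.Eventually.of_forall fun s _ => (summable_pow_div_Gamma hα _).hasSum.mul_left _
  -- By the Beta integral, Abel integration sends term n of the series to a constant multiple of
  -- term n + 1.
  have hterm (n : ℕ) : ∫ s in (0 : ℝ)..t,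
      (t - s) ^ (α - 1) * ((-c * s ^ α) ^ n / Real.Gamma (n * α + 1)) =
      -(Real.Gamma α / c) * ((-c * t ^ α) ^ (n + 1) / Real.Gamma ((n + 1 : ℕ) * α + 1)) := by
    have h := integral_sub_rpow_mul_rpow hα (β := n * α + 1) (by positivity) ht
    have hG := (Gamma_natCast_mul_add_one_pos hα n).ne'
    have hpow {s : ℝ} (hs : 0 ≤ s) (k : ℕ) : (s ^ α) ^ k = s ^ (k * α) := by
      rw [← Real.rpow_natCast, ← Real.rpow_mul hs, mul_comm]
    calc _ = ∫ s in (0 : ℝ)..t, ((-c) ^ n / Real.Gamma (n * α + 1)) *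
          ((t - s) ^ (α - 1) * s ^ (n * α + 1 - 1)) := by
          refine intervalIntegral.integral_congr fun s hs => ?_
          rw [uIcc_of_le ht.le] at hs
          simp only [mul_pow, hpow hs.1, add_sub_cancel_right]
          ring
      _ = _ := by
          rw [intervalIntegral.integral_const_mul, h, mul_pow, hpow ht.le, pow_succ]
          have e1 : α + (n * α + 1) = (n + 1 : ℕ) * α + 1 := by push_cast; ring
          rw [e1, add_sub_cancel_right]
          field_simp
  simp_rw [hterm] at key
  have h0 : mittagLeffler α (-c * t ^ α) = 1 + ∑' n : ℕ,
      (-c * t ^ α) ^ (n + 1) / Real.Gamma ((n + 1 : ℕ) * α + 1) := by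
    rw [mittagLeffler, (summable_pow_div_Gamma hα _).tsum_eq_zero_add]
    simp
  rw [h0, ← key.tsum_eq, tsum_mul_left, ← mul_assoc, mul_neg, div_mul_div_cancel₀ hΓ.ne',
    div_self hc.ne', neg_one_mul, sub_neg_eq_add]

/-! ### Positivity for Volterra equations -/

theorem integral_sub_rpow {α a t : ℝ} (hα : 0 < α) :
    ∫ s in a..t, (t - s) ^ (α - 1) = (t - a) ^ α / α := by
  rw [intervalIntegral.integral_comp_sub_left (fun u => u ^ (α - 1)) t, sub_self,
    integral_rpow (Or.inl (by linarith)), sub_add_cancel, Real.zero_rpow hα.ne', sub_zero]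

theorem intervalIntegrable_sub_rpow_mul {α a b : ℝ} (hα : 0 < α) {f : ℝ → ℝ}
    (hf : ContinuousOn f (Ici 0)) (ha : 0 ≤ a) (hb : 0 ≤ b) (t : ℝ) :
    IntervalIntegrable (fun s => (t - s) ^ (α - 1) * f s) volume a b :=
  (intervalIntegrable_sub_rpow hα t a b).mul_continuousOn
    (hf.mono fun _ hx => (le_min ha hb).trans hx.1)

/-- Positivity of the solution of a linear Volterra equation with an Abel kernel, when the forcing
term is positive and decays at most as fast as the kernel. -/
theorem pos_of_volterra {α C : ℝ} (hα0 : 0 < α) (hC : 0 < C) {f g : ℝ → ℝ}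
    (hf : ContinuousOn f (Ici 0)) (hg : ∀ t, 0 ≤ t → 0 < g t)
    (heq : ∀ t, 0 ≤ t → f t = g t - C * ∫ s in (0 : ℝ)..t, (t - s) ^ (α - 1) * f s)
    (hkernel : ∀ t t₁ s, 0 ≤ s → s < t → t < t₁ →
      g t * (t₁ - s) ^ (α - 1) ≤ g t₁ * (t - s) ^ (α - 1))
    {x : ℝ} (hx : 0 ≤ x) : 0 < f x := by
  by_contra! hfx
  set S : Set ℝ := Ici 0 ∩ f ⁻¹' Iic 0
  have hS : IsClosed S := hf.preimage_isClosed_of_isClosed isClosed_Ici isClosed_Iic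
  have hbdd : BddBelow S := ⟨0, fun y hy => hy.1⟩
  have hmem : sInf S ∈ S := hS.csInf_mem ⟨x, hx, hfx⟩ hbdd
  set t₁ := sInf S
  have hpos : ∀ s, 0 ≤ s → s < t₁ → 0 < f s := fun s h0 hs => by
    by_contra! h
    exact (csInf_le hbdd (⟨h0, h⟩ : s ∈ S)).not_gt hs
  have hft₁ : f t₁ ≤ 0 := hmem.2
  have ht₁ : 0 < t₁ := by
    refine lt_of_le_of_ne hmem.1 fun h => ?_
    have h1 := heq 0 le_rfl
    rw [intervalIntegral.integral_same, mul_zero, sub_zero] at h1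
    rw [← h, h1] at hft₁
    exact (hg 0 le_rfl).not_ge hft₁
  -- C δ^α/α bounds the kernel's mass on the last stretch before the first zero t₁; it must stay
  -- below the ratio bound 1/2 obtained from δ ≤ t₁/2.
  obtain ⟨δ, hδ0, hδt, hδ⟩ : ∃ δ : ℝ, 0 < δ ∧ δ ≤ t₁ / 2 ∧ C * (δ ^ α / α) < 1 / 2 := by
    have hlim : Filter.Tendsto (fun δ : ℝ => C * (δ ^ α / α)) (nhdsWithin 0 (Ioi 0)) (nhds 0) := by
      have : Continuous fun δ : ℝ => C * (δ ^ α / α) :=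
        continuous_const.mul ((Real.continuous_rpow_const hα0.le).div_const _)
      have h := this.tendsto 0
      simp only [Real.zero_rpow hα0.ne', zero_div, mul_zero] at h
      exact h.mono_left nhdsWithin_le_nhds
    have h2 : ∀ᶠ δ in nhdsWithin (0 : ℝ) (Ioi 0), δ ∈ Ioc 0 (t₁ / 2) :=
      Ioc_mem_nhdsGT (by linarith)
    obtain ⟨δ, h3, h4⟩ := ((hlim.eventually_lt_const (by norm_num : (0 : ℝ) < 1 / 2)).and h2).exists
    exact ⟨δ, h4.1, h4.2, h3⟩
  -- Comparing t₁ with a maximum point t bounds f by f t on [t, t₁].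
  obtain ⟨t, ht, hmax⟩ := isCompact_Icc.exists_isMaxOn
    (nonempty_Icc.2 (by linarith : t₁ - δ ≤ t₁)) (hf.mono fun y hy => by
      have := hy.1
      exact mem_Ici.2 (by linarith))
  have ht0 : 0 < t := by linarith [ht.1]
  have hft : 0 < f t := (hpos (t₁ - δ) (by linarith) (by linarith)).trans_le
    (hmax (left_mem_Icc.2 (by linarith)))
  have htt₁ : t < t₁ := lt_of_le_of_ne ht.2 fun h => by rw [h] at hft; linarith
  have hgt := hg t ht0.le
  have hgt₁ := hg t₁ ht₁.le
  have hratio : 1 / 2 ≤ g t₁ / g t := by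
    have h1 := hkernel t t₁ 0 le_rfl ht0 htt₁
    rw [sub_zero, sub_zero] at h1
    have h2 : t * t ^ (α - 1) ≤ t₁ * t₁ ^ (α - 1) := by
      rw [← Real.rpow_one_add' ht0.le (by linarith), ← Real.rpow_one_add' ht₁.le (by linarith)]
      exact Real.rpow_le_rpow ht0.le htt₁.le (by linarith)
    have h3 : 0 < t ^ (α - 1) := Real.rpow_pos_of_pos ht0 _
    have h4 : 0 < t₁ ^ (α - 1) := Real.rpow_pos_of_pos ht₁ _
    have h5 : t ^ (α - 1) ≤ 2 * t₁ ^ (α - 1) := by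
      have : t₁ ≤ 2 * t := by linarith [ht.1]
      refine le_of_mul_le_mul_left (h2.trans ?_) ht0
      nlinarith
    rw [le_div_iff₀ hgt]
    refine le_of_mul_le_mul_right ?_ h4
    nlinarith
  have hI {a b : ℝ} (ha : 0 ≤ a) (hb : 0 ≤ b) (t : ℝ) :=
    intervalIntegrable_sub_rpow_mul hα0 hf ha hb t
  have hfar : ∫ s in (0 : ℝ)..t, (t₁ - s) ^ (α - 1) * f s ≤
      g t₁ / g t * ∫ s in (0 : ℝ)..t, (t - s) ^ (α - 1) * f s := by
    rw [← intervalIntegral.integral_const_mul]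
    refine intervalIntegral.integral_mono_on_of_le_Ioo ht0.le (hI le_rfl ht0.le t₁)
      ((hI le_rfl ht0.le t).const_mul _) fun s hs => ?_
    have h1 := hkernel t t₁ s hs.1.le hs.2 htt₁
    have h2 := hpos s hs.1.le (hs.2.trans htt₁)
    rw [← mul_assoc]
    refine mul_le_mul_of_nonneg_right ?_ h2.le
    rw [div_mul_eq_mul_div, le_div_iff₀ hgt]
    linarith
  have hnear : ∫ s in t..t₁, (t₁ - s) ^ (α - 1) * f s ≤ (δ ^ α / α) * f t := by
    calc _ ≤ ∫ s in t..t₁, (t₁ - s) ^ (α - 1) * f t := by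
          refine intervalIntegral.integral_mono_on htt₁.le (hI ht0.le ht₁.le t₁)
            ((intervalIntegrable_sub_rpow hα0 t₁ t t₁).mul_const _) fun s hs => ?_
          exact mul_le_mul_of_nonneg_left (hmax ⟨ht.1.trans hs.1, hs.2⟩)
            (Real.rpow_nonneg (sub_nonneg.2 hs.2) _)
      _ = (t₁ - t) ^ α / α * f t := by
          rw [intervalIntegral.integral_mul_const, integral_sub_rpow hα0]
      _ ≤ _ := by
          have : t₁ - t ≤ δ := by linarith [ht.1]
          have : 0 ≤ t₁ - t := by linarith
          gcongr
  have hsplit := intervalIntegral.integral_add_adjacent_intervals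
    (hI le_rfl ht0.le t₁) (hI ht0.le ht₁.le t₁)
  have e1 := heq t₁ ht₁.le
  have e2 := heq t ht0.le
  rw [← hsplit] at e1
  set I := ∫ s in (0 : ℝ)..t, (t - s) ^ (α - 1) * f s
  -- Together, f t₁ ≥ (g t₁ / g t - C δ^α/α) f t > 0, contradicting f t₁ ≤ 0.
  have h1 : g t₁ - C * (g t₁ / g t * I) = g t₁ / g t * f t := by
    rw [e2]
    field_simp
  have h2 := mul_le_mul_of_nonneg_left hfar hC.le
  have h3 := mul_le_mul_of_nonneg_left hnear hC.le
  have h4 := mul_le_mul_of_nonneg_right hratio hft.le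
  have h5 := mul_lt_mul_of_pos_right hδ hft
  linarith

/-! ### Positivity and strict decrease of the kernel -/

theorem continuous_mittagLeffler_rpow {α : ℝ} (hα : 0 < α) (c : ℝ) :
    Continuous fun t : ℝ => mittagLeffler α (-c * t ^ α) :=
  (differentiable_mittagLeffler hα).continuous.comp
    (continuous_const.mul (Real.continuous_rpow_const hα.le))

theorem mittagLeffler_neg_mul_rpow_pos {α c t : ℝ} (hα0 : 0 < α) (hα1 : α < 1) (hc : 0 < c)
    (ht : 0 ≤ t) : 0 < mittagLeffler α (-c * t ^ α) := by
  refine pos_of_volterra (f := fun t => mittagLeffler α (-c * t ^ α)) (g := fun _ => 1) hα0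
    (div_pos hc (Real.Gamma_pos_of_pos hα0)) (continuous_mittagLeffler_rpow hα0 c).continuousOn
    (fun _ _ => one_pos) (fun t ht => mittagLeffler_volterra hα0 hc ht)
    (fun t t₁ s _ hst htt₁ => ?_) ht
  rw [one_mul, one_mul]
  exact Real.rpow_le_rpow_of_nonpos (sub_pos.2 hst) (by linarith) (by linarith)

theorem mittagLeffler_neg_mul_rpow_add_lt {α c t h : ℝ} (hα0 : 0 < α) (hα1 : α < 1) (hc : 0 < c)
    (hh : 0 < h) (ht : 0 ≤ t) :
    mittagLeffler α (-c * (t + h) ^ α) < mittagLeffler α (-c * t ^ α) := by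
  set k : ℝ → ℝ := fun t => mittagLeffler α (-c * t ^ α) with hk
  set C : ℝ := c / Real.Gamma α
  have hC : 0 < C := div_pos hc (Real.Gamma_pos_of_pos hα0)
  have hcont : Continuous k := continuous_mittagLeffler_rpow hα0 c
  have hcont' : Continuous fun t => k (t + h) := hcont.comp (continuous_id.add continuous_const)
  have hkpos : ∀ s, 0 ≤ s → 0 < k s := fun s hs => mittagLeffler_neg_mul_rpow_pos hα0 hα1 hc hs
  have hvol : ∀ t, 0 ≤ t → k t = 1 - C * ∫ s in (0 : ℝ)..t, (t - s) ^ (α - 1) * k s :=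
    fun t ht => mittagLeffler_volterra hα0 hc ht
  have hI {f : ℝ → ℝ} (hf : Continuous f) {a b : ℝ} (ha : 0 ≤ a) (hb : 0 ≤ b) (t : ℝ) :=
    intervalIntegrable_sub_rpow_mul hα0 hf.continuousOn ha hb t
  rw [← sub_pos]
  -- Subtracting the equation at t + h from that at t leaves as forcing the memory of [0, h],
  -- positive since k is.
  refine pos_of_volterra (f := fun t => k t - k (t + h))
    (g := fun t => C * ∫ s in (0 : ℝ)..h, (t + h - s) ^ (α - 1) * k s) hα0 hC
    (hcont.sub hcont').continuousOn (fun t ht => ?_) (fun t ht => ?_)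
    (fun t t₁ s hs hst htt₁ => ?_) ht
  · refine mul_pos hC (intervalIntegral.intervalIntegral_pos_of_pos_on
      (hI hcont le_rfl hh.le (t + h)) (fun s hs => ?_) hh)
    exact mul_pos (Real.rpow_pos_of_pos (by linarith [hs.2]) _) (hkpos s hs.1.le)
  · have h1 := hvol t ht
    have h2 := hvol (t + h) (by linarith)
    have h3 := intervalIntegral.integral_add_adjacent_intervals
      (hI hcont le_rfl hh.le (t + h)) (hI hcont hh.le (by linarith : 0 ≤ t + h) (t + h))
    have h4 : ∫ s in h..t + h, (t + h - s) ^ (α - 1) * k s =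
        ∫ s in (0 : ℝ)..t, (t - s) ^ (α - 1) * k (s + h) := by
      have := intervalIntegral.integral_comp_add_right (a := 0) (b := t)
        (fun s => (t + h - s) ^ (α - 1) * k s) h
      rw [zero_add] at this
      rw [← this]
      simp only [add_sub_add_right_eq_sub]
    have h5 : ∫ s in (0 : ℝ)..t, (t - s) ^ (α - 1) * (k s - k (s + h)) =
        (∫ s in (0 : ℝ)..t, (t - s) ^ (α - 1) * k s) -
          ∫ s in (0 : ℝ)..t, (t - s) ^ (α - 1) * k (s + h) := by
      simp_rw [mul_sub]
      exact intervalIntegral.integral_sub (hI hcont le_rfl ht t) (hI hcont' le_rfl ht t)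
    rw [← h3, h4] at h2
    rw [h5]
    linear_combination h1 - h2
  · have e (x : ℝ) (y : ℝ) : C * (∫ s in (0 : ℝ)..h, (x + h - s) ^ (α - 1) * k s) * y =
        C * ∫ s in (0 : ℝ)..h, y * ((x + h - s) ^ (α - 1) * k s) := by
      rw [intervalIntegral.integral_const_mul]
      ring
    rw [e, e]
    refine mul_le_mul_of_nonneg_left (intervalIntegral.integral_mono_on hh.le
      ((hI hcont le_rfl hh.le _).const_mul _) ((hI hcont le_rfl hh.le _).const_mul _)
      fun u hu => ?_) hC.le
    rw [← mul_assoc, ← mul_assoc]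
    have p1 : 0 < t - s := by linarith
    have p2 : 0 < t₁ - s := by linarith
    have p3 : 0 < t + h - u := by linarith [hu.2]
    have p4 : 0 < t₁ + h - u := by linarith [hu.2]
    refine mul_le_mul_of_nonneg_right ?_ (hkpos u hu.1).le
    rw [← Real.mul_rpow p2.le p3.le, ← Real.mul_rpow p1.le p4.le]
    refine Real.rpow_le_rpow_of_nonpos (mul_pos p1 p4) ?_ (by linarith)
    -- (t₁-s)(t+h-u) - (t-s)(t₁+h-u) = (t₁-t)(h-u+s).
    nlinarith [mul_nonneg (sub_pos.2 htt₁).le (by linarith [hu.2] : 0 ≤ h - u + s)]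

/-! ### Integration by parts and the sign of the derivative -/

/-- If `m ≤ 0` on `[0, a)` and `m a = 0`, then `m'` has a nonnegative integral over `[0, a]` against
the reflection of a nonnegative decreasing kernel. -/
theorem integral_antitone_kernel_mul_deriv_nonneg {a : ℝ} (ha : 0 < a) {k m : ℝ → ℝ}
    (hk : ContinuousOn k (Icc 0 a)) (hkd : DifferentiableOn ℝ k (Ioo 0 a))
    (hanti : AntitoneOn k (Icc 0 a)) (hkpos : 0 ≤ k a)
    (hm : ContinuousOn m (Icc 0 a)) (hmd : DifferentiableOn ℝ m (Ioo 0 a))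
    (hm' : IntervalIntegrable (deriv m) volume 0 a)
    (hneg : ∀ s ∈ Ico 0 a, m s ≤ 0) (hzero : m a = 0) :
    0 ≤ ∫ s in (0 : ℝ)..a, k (a - s) * deriv m s := by
  have hrefl : MapsTo (fun s => a - s) (Icc 0 a) (Icc 0 a) := fun s hs =>
    ⟨by linarith [hs.2], by linarith [hs.1]⟩
  have hrefl' : MapsTo (fun s => a - s) (Ioo 0 a) (Ioo 0 a) := fun s hs =>
    ⟨by linarith [hs.2], by linarith [hs.1]⟩
  set u : ℝ → ℝ := fun s => k (a - s) with hu
  have hucont : ContinuousOn u (Icc 0 a) := hk.comp (by fun_prop) hrefl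
  have humono : MonotoneOn u (Icc 0 a) := fun x hx y hy hxy =>
    hanti (hrefl hy) (hrefl hx) (by linarith : a - y ≤ a - x)
  have hud : ∀ s ∈ Ioo 0 a, HasDerivAt u (deriv u s) s := fun s hs => by
    have h1 : DifferentiableAt ℝ k (a - s) :=
      (hkd _ (hrefl' hs)).differentiableAt (Ioo_mem_nhds (hrefl' hs).1 (hrefl' hs).2)
    exact (h1.comp s (by fun_prop)).hasDerivAt
  have hu0 : ∀ s ∈ Ioo 0 a, 0 ≤ deriv u s := fun s hs => by
    rw [← derivWithin_of_mem_nhds (Icc_mem_nhds hs.1 hs.2)]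
    exact humono.derivWithin_nonneg
  have hmd' : ∀ s ∈ Ioo 0 a, HasDerivAt m (deriv m s) s := fun s hs =>
    ((hmd s hs).differentiableAt (Ioo_mem_nhds hs.1 hs.2)).hasDerivAt
  -- In the application u' blows up at a, like (a-s)^(α-1); its sign and the continuity of u still
  -- give integrability.
  have hu' : IntervalIntegrable (deriv u) volume 0 a := by
    rw [intervalIntegrable_iff_integrableOn_Ioc_of_le ha.le]
    exact intervalIntegral.integrableOn_deriv_of_nonneg hucont hud hu0
  rw [← uIcc_of_le ha.le] at hucont hm
  rw [intervalIntegral.integral_mul_deriv_eq_deriv_mul_of_hasDerivAt hucont hm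
    (by simpa [ha.le] using hud) (by simpa [ha.le] using hmd') hu' hm', hzero, mul_zero]
  have h1 : ∫ s in (0 : ℝ)..a, deriv u s * m s ≤ 0 := by
    have : ∫ s in (0 : ℝ)..a, deriv u s * m s ≤ ∫ s in (0 : ℝ)..a, 0 :=
      intervalIntegral.integral_mono_on_of_le_Ioo ha.le (hu'.mul_continuousOn hm) (by simp)
        fun s hs => mul_nonpos_of_nonneg_of_nonpos (hu0 s hs) (hneg s ⟨hs.1.le, hs.2⟩)
    simpa using this
  have h2 : u 0 * m 0 ≤ 0 :=
    mul_nonpos_of_nonneg_of_nonpos (by simpa [hu] using hkpos) (hneg 0 ⟨le_rfl, ha⟩)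
  linarith

theorem abcDeriv_nonneg_of_nonpos {B : ℝ → ℝ} {α a : ℝ} (hB : 0 ≤ B α) (hα0 : 0 < α) (hα1 : α < 1)
    (ha : 0 < a) {m : ℝ → ℝ} (hm : DifferentiableOn ℝ m (Icc 0 a))
    (hm' : IntervalIntegrable (deriv m) volume 0 a)
    (hneg : ∀ s ∈ Ico 0 a, m s ≤ 0) (hzero : m a = 0) : 0 ≤ abcDeriv B α m a := by
  have hc : 0 < α / (1 - α) := div_pos hα0 (by linarith)
  refine mul_nonneg (div_nonneg hB (by linarith)) ?_
  refine integral_antitone_kernel_mul_deriv_nonneg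
    (k := fun t => mittagLeffler α (-(α / (1 - α)) * t ^ α)) ha
    (continuous_mittagLeffler_rpow hα0 _).continuousOn (fun t ht => ?_) (fun x hx y _ hxy => ?_)
    (mittagLeffler_neg_mul_rpow_pos hα0 hα1 hc ha.le).le hm.continuousOn
    (hm.mono Ioo_subset_Icc_self) hm' hneg hzero
  · exact ((differentiable_mittagLeffler hα0 _).comp t ((Real.differentiableAt_rpow_const_of_ne α
      ht.1.ne').const_mul _)).differentiableWithinAt
  · rcases hxy.eq_or_lt with rfl | hlt
    · exact le_rfl
    · have := mittagLeffler_neg_mul_rpow_add_lt hα0 hα1 hc (sub_pos.2 hlt) hx.1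
      rw [add_sub_cancel] at this
      exact this.le

theorem mainTheorem1 (B : ℝ → ℝ) (hB : IsNormalization B) (α : ℝ) (hα0 : 0 < α) (hα1 : α < 1)
    (T : ℝ) (hT : 0 < T) (m : ℝ → ℝ) (hm : DifferentiableOn ℝ m (Icc 0 T))
    (hm' : IntervalIntegrable (deriv m) volume 0 T)
    (hcont : ContinuousOn (abcDeriv B α m) (Icc 0 T))
    (τ₀ : ℝ) (hτ₀ : τ₀ ∈ Ioc 0 T) (hzero : m τ₀ = 0) :
    ((∀ τ ∈ Ico 0 τ₀, m τ ≤ 0) → 0 ≤ abcDeriv B α m τ₀) ∧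
      ((∀ τ ∈ Ico 0 τ₀, 0 ≤ m τ) → abcDeriv B α m τ₀ ≤ 0) := by
  have hBα : 0 ≤ B α := (hB.1 α ⟨hα0.le, hα1.le⟩).le
  have hd : DifferentiableOn ℝ m (Icc 0 τ₀) := hm.mono (Icc_subset_Icc_right hτ₀.2)
  have hi : IntervalIntegrable (deriv m) volume 0 τ₀ := hm'.mono_set <| by
    rw [uIcc_of_le hτ₀.1.le, uIcc_of_le hT.le]
    exact Icc_subset_Icc_right hτ₀.2
  refine ⟨fun h => abcDeriv_nonneg_of_nonpos hBα hα0 hα1 hτ₀.1 hd hi h hzero, fun h => ?_⟩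
  have hderiv : deriv (-m) = -deriv m := funext fun s => deriv.neg
  have key := abcDeriv_nonneg_of_nonpos (m := -m) hBα hα0 hα1 hτ₀.1 hd.neg
    (by rw [hderiv]; exact hi.neg) (fun s hs => neg_nonpos.2 (h s hs)) (by simp [hzero])
  have hneg : abcDeriv B α (-m) τ₀ = -abcDeriv B α m τ₀ := by
    simp only [abcDeriv, hderiv, Pi.neg_apply, mul_neg, intervalIntegral.integral_neg]
  rw [hneg] at key
  linarith
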